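/- Let $\mathfrak m$ be an uncountable cardinal such that $\sup\{\mathfrak m^{\mathfrak n} : \mathfrak n<\mathfrak m\}=\mathfrak m$. The weight of a topological space is the least cardinality of a base of its topology. A Urysohn--Katětov space of weight $\mathfrak m$ is a complete metric space $U$ of weight $\mathfrak m$ such that (a) $U$ is $\mathfrak m$-homogeneous: every isometry from a subset $A\subseteq U$ onto a subset $B\subseteq U$, with $|A|<\mathfrak m$ and $|B|<\mathfrak m$, extends to an isometry of $U$ onto itself; (b) $U$ is strongly $\mathfrak m$-universal: every metric space of weight $\le\mathfrak m$ embeds isometrically into $U$. Then there is, up to isometry, exactly one Urysohn--Katětov space of weight $\mathfrak m$; denote it by $\mathbb U_{\mathfrak m}$. Let $\mathrm{Iso}(\mathbb U_{\mathfrak m})$ be the group of all isometries of $\mathbb U_{\mathfrak m}$ onto itself, with the topology of pointwise convergence on the metric space $\mathbb U_{\mathfrak m}$. Every metrizable topological group $G$ of weight $\le\mathfrak m$ which is SIN (for every neighbourhood $W$ of the identity there is a neighbourhood $V$ of the identity with $x^{-1}Vx\subseteq W$ for all $x\in G$) is isomorphic, as a topological group, to a subgroup of $\mathrm{Iso}(\mathbb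 U_{\mathfrak m})$ with the subspace topology. -/

import Mathlib

open Cardinal Topology

universe u

/-- The weight of a topological space: the least cardinality of a base of its topology. -/
noncomputable def topWeight (X : Type u) [TopologicalSpace X] : Cardinal.{u} :=
  sInf {c | ∃ B : Set (Set X), TopologicalSpace.IsTopologicalBasis B ∧ #B = c}

/-- `X` is `τ`-homogeneous: every isometry of one subset of cardinality `< τ` onto another extends
to an isometry of `X` onto itself. -/
def IsCardHomogeneous (τ : Cardinal.{u}) (X : Type u) [MetricSpace X] : Prop :=
  ∀ A B : Set X, #A < τ → #B < τ → ∀ f : A ≃ᵢ B, ∃ g : X ≃ᵢ X, ∀ a : A, g a = f a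

/-- `X` is strongly `τ`-universal: every metric space of weight `≤ τ` embeds isometrically
into `X`. -/
def IsStronglyUniversal (τ : Cardinal.{u}) (X : Type u) [MetricSpace X] : Prop :=
  ∀ (Y : Type u) [MetricSpace Y], topWeight Y ≤ τ → ∃ i : Y → X, Isometry i

/-- `X` is a Urysohn–Katětov space `𝕌_τ`: a complete metric space of weight `τ` which is
`τ`-homogeneous and strongly `τ`-universal. -/
structure IsUrysohnKatetov (τ : Cardinal.{u}) (X : Type u) [MetricSpace X] : Prop where
  complete : CompleteSpace X
  weight_eq : topWeight X = τ
  homogeneous : IsCardHomogeneous τ X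
  universal : IsStronglyUniversal τ X

/-- SIN (small invariant neighbourhoods) groups: every neighbourhood `U` of the identity contains
all conjugates `x⁻¹ V x` of some neighbourhood `V` of the identity. -/
def IsSINGroup (G : Type u) [Group G] [TopologicalSpace G] : Prop :=
  ∀ U ∈ 𝓝 (1 : G), ∃ V ∈ 𝓝 (1 : G), ∀ x : G, ∀ v ∈ V, x⁻¹ * v * x ∈ U

/-- The topology of pointwise convergence on the group `Iso(X) = (X ≃ᵢ X)` of isometries of `X`
onto itself: the one induced by the product topology on `X → X`. -/
@[reducible] def isoPointwiseTopology (X : Type u) [MetricSpace X] : TopologicalSpace (X ≃ᵢ X) :=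
  TopologicalSpace.induced (fun (g : X ≃ᵢ X) (x : X) => g x) Pi.topologicalSpace

/-!
Let `m ^ n ≤ m` for all `n < m`. Then `m` is regular, and a metric space has weight `≤ m` if and
only if it has at most `m` points. The whole theorem rests on one property of a metric space `X`
(`RealizesKatetov`): every Katětov function on a set of fewer than `m` points of `X` is the distance
to some point of `X`.

A space with at most `m` points is Urysohn–Katětov of weight `m` exactly when it has this property.
One direction (`IsUrysohnKatetov.realizesKatetov`) embeds a one-point extension by universality and
moves it into place by homogeneity. For the other one
(`RealizesKatetov.isUrysohnKatetov`), universality is a transfinite construction going forth,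
homogeneity is back-and-forth, and completeness holds since Cauchy sequences are small sets.
Back-and-forth also yields uniqueness.

For existence and for the embedding of groups together, let `G` be a group with a bi-invariant
pseudometric and at most `m` elements. A metric on `G × m` (with `m` identified with its initial
ordinal) is defined by recursion on the second coordinate, the level. Level `⊥` is a copy of `G`. The
points `(g, i)` of a higher level `i` are the translates of `(1, i)`, whose distances to points of
lower level are given by the `i`-th Katětov function in an enumeration of all data in which each item
recurs cofinally; two points of level `i` have the uniform distance of the Katětov functions defining
them. Since `m` is regular,
every Katětov function on a small set is realized. The group acts by left translation, and the bound
`d (g x) (h x) ≤ dist g h`, uniform in `x`, passes from lower levels to level `i`, because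
translating a Katětov function changes it by at most the displacement of the points
(`isEquivariantDistOn_Iic`). With equality on the orbit of `(1, ⊥)`, the topology of pointwise
convergence on isometries induces the topology of `G`
(`isEmbedding_isoPointwise_of_dist`).

The trivial group gives existence. A metrizable SIN group has a compatible bi-invariant metric
(`IsSINGroup.exists_biinvariant_pseudoMetric`), and the action obtained is transported to the given
space by uniqueness.
-/

/-! ### Cardinal arithmetic -/

theorem power_le_of_iSup_power_eq {m : Cardinal.{u}}
    (hpow : (⨆ n : Set.Iio m, m ^ (n : Cardinal.{u})) = m) {n : Cardinal.{u}} (hn : n < m) :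
    m ^ n ≤ m :=
  (le_powerlt m hn).trans_eq hpow

/-- By König's theorem `m < m ^ cof m`, an infinite `m` with `m ^ n ≤ m` for all `n < m` has
cofinality `m`. -/
theorem isRegular_of_power_le {m : Cardinal.{u}} (hm : ℵ₀ ≤ m) (hpow : ∀ n < m, m ^ n ≤ m) :
    m.IsRegular := by
  refine ⟨hm, ?_⟩
  by_contra! h
  exact (lt_power_cof_ord hm).not_ge (hpow _ h)

theorem nonempty_toType_ord {m : Cardinal.{u}} (hm : ℵ₀ ≤ m) : Nonempty m.ord.ToType := by
  rw [← mk_ne_zero_iff, mk_ord_toType]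
  exact (aleph0_pos.trans_le hm).ne'

theorem mk_Iio_toType_lt {m : Cardinal.{u}} (i : m.ord.ToType) : #(Set.Iio i) < m := by
  simpa using mk_Iio_lt i

theorem mk_Iic_toType_ord_lt {m : Cardinal.{u}} (hm : ℵ₀ ≤ m) (i : m.ord.ToType) :
    #(Set.Iic i) < m := by
  rw [← Set.Iio_insert]
  exact (mk_insert_le).trans_lt
    (add_lt_of_lt hm (mk_Iio_toType_lt i) (one_lt_aleph0.trans_le hm))

theorem exists_forall_lt_of_isRegular {m : Cardinal.{u}} (hm : m.IsRegular) (S : Set m.ord.ToType)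
    (hS : #S < m) : ∃ i, ∀ j ∈ S, j < i := by
  by_contra! h
  have hU : (⋃ j : S, Set.Iic (j : m.ord.ToType)) = Set.univ := by
    ext i
    obtain ⟨j, hj, hij⟩ := h i
    simpa using ⟨j, hj, hij⟩
  have := (card_iUnion_lt_iff_forall_of_isRegular hm hS).2
    fun j : S => mk_Iic_toType_ord_lt hm.1 (j : m.ord.ToType)
  rw [hU, mk_univ, mk_ord_toType] at this
  exact this.false

theorem exists_mk_Iio_eq {m a : Cardinal.{u}} (h : a < m) :
    ∃ i : m.ord.ToType, #(Set.Iio i) = a := by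
  obtain ⟨i, hi⟩ := Ordinal.mem_range_typein_iff (· < · : m.ord.ToType → m.ord.ToType → Prop) |>.2
    ((ord_lt_ord.2 h).trans_eq (Ordinal.type_toType _).symm)
  refine ⟨i, ?_⟩
  rw [← Ordinal.card_type (α := Set.Iio i) (· < ·), Ordinal.type_Iio_lt, hi, card_ord]

/-- There are at most `m` subsets of cardinality `< m`. -/
theorem mk_setOf_card_lt_le {m : Cardinal.{u}} (hm : ℵ₀ ≤ m) (hpow : ∀ n < m, m ^ n ≤ m)
    {X : Type u} (hX : #X ≤ m) : #{s : Set X // #s < m} ≤ m := by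
  have hmax : max #X ℵ₀ ≤ m := max_le hX hm
  have hU : {s : Set X | #s < m} ⊆ ⋃ i : m.ord.ToType, {s | #s ≤ #(Set.Iio i)} := by
    intro s hs
    obtain ⟨i, hi⟩ := exists_mk_Iio_eq hs
    exact Set.mem_iUnion.2 ⟨i, hi.ge⟩
  refine (mk_le_mk_of_subset hU).trans ((mk_iUnion_le _).trans ?_)
  rw [mk_ord_toType]
  refine (mul_le_mul_right (ciSup_le' fun i => ?_) _).trans (mul_eq_self hm).le
  exact (mk_bounded_set_le X _).trans
    ((power_le_power_right hmax).trans (hpow _ (mk_Iio_toType_lt i)))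

/-- Bookkeeping: an enumeration of a set of size `≤ m` in which every element recurs cofinally. -/
theorem exists_cofinal_enumeration {m : Cardinal.{u}} (hm : ℵ₀ ≤ m) {P : Type u} [Nonempty P]
    (hP : #P ≤ m) : ∃ e : m.ord.ToType → P, ∀ p i, ∃ j, i < j ∧ e j = p := by
  have : Nonempty m.ord.ToType := nonempty_toType_ord hm
  have hle : #(m.ord.ToType × P) ≤ #m.ord.ToType := by
    rw [mk_prod, lift_id, lift_id, mk_ord_toType]
    exact (mul_le_mul_right hP _).trans (mul_eq_self hm).le
  obtain ⟨f⟩ := hle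
  refine ⟨fun j => (Function.invFun f j).2, fun p i => ?_⟩
  by_contra! h
  have hsub : Set.range (fun k => f (k, p)) ⊆ Set.Iic i := by
    rintro _ ⟨k, rfl⟩
    by_contra hk
    refine h _ (not_le.1 hk) ?_
    rw [Function.leftInverse_invFun f.injective]
  have hc := (mk_le_mk_of_subset hsub).trans_lt (mk_Iic_toType_ord_lt hm i)
  rw [mk_range_eq _ (fun a b hab => (Prod.ext_iff.1 (f.injective hab)).1), mk_ord_toType] at hc
  exact hc.false

/-! ### Weight -/

theorem exists_isTopologicalBasis_mk_eq_topWeight (X : Type u) [TopologicalSpace X] :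
    ∃ B : Set (Set X), TopologicalSpace.IsTopologicalBasis B ∧ #B = topWeight X :=
  csInf_mem (s := {c | ∃ B : Set (Set X), TopologicalSpace.IsTopologicalBasis B ∧ #B = c})
    ⟨_, _, TopologicalSpace.isTopologicalBasis_opens, rfl⟩

theorem topWeight_le_of_mk_le {m : Cardinal.{u}} (hm : ℵ₀ ≤ m) {X : Type u} [MetricSpace X]
    (hX : #X ≤ m) : topWeight X ≤ m := by
  have hB : TopologicalSpace.IsTopologicalBasis
      (Set.range fun p : X × ℕ => Metric.ball p.1 (1 / (p.2 + 1) : ℝ)) := by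
    refine TopologicalSpace.isTopologicalBasis_of_isOpen_of_nhds ?_ fun x U hx hU => ?_
    · rintro _ ⟨p, rfl⟩
      exact Metric.isOpen_ball
    · obtain ⟨ε, hε, hεU⟩ := Metric.isOpen_iff.1 hU x hx
      obtain ⟨n, hn⟩ := exists_nat_one_div_lt hε
      exact ⟨_, ⟨(x, n), rfl⟩, Metric.mem_ball_self Nat.one_div_pos_of_nat,
        (Metric.ball_subset_ball hn.le).trans hεU⟩
  refine (show topWeight X ≤ _ from csInf_le' ⟨_, hB, rfl⟩).trans (mk_range_le.trans ?_)
  simpa using (mul_le_mul' hX hm).trans (mul_eq_self hm).le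

/-- A point is determined by a countable family of basic open sets shrinking to it, so there are
at most `w ^ ℵ₀` points in a metric space of weight `w`. -/
theorem mk_le_of_topWeight_le {m : Cardinal.{u}} (hm : m ^ ℵ₀ ≤ m) {X : Type u} [MetricSpace X]
    (hX : topWeight X ≤ m) : #X ≤ m := by
  obtain ⟨B, hB, hBX⟩ := exists_isTopologicalBasis_mk_eq_topWeight X
  have h : ∀ (x : X) (n : ℕ), ∃ b : B, x ∈ (b : Set X) ∧
      (b : Set X) ⊆ Metric.ball x (1 / (n + 1) : ℝ) := fun x n => by
    obtain ⟨b, hb, hxb, hsub⟩ := hB.exists_subset_of_mem_open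
      (Metric.mem_ball_self (x := x) (ε := (1 / (n + 1) : ℝ)) Nat.one_div_pos_of_nat)
      Metric.isOpen_ball
    exact ⟨⟨b, hb⟩, hxb, hsub⟩
  choose b hxb hsub using h
  have hinj : Function.Injective b := fun x y hxy => by
    refine dist_le_zero.1 (le_of_forall_pos_lt_add fun ε hε => ?_)
    obtain ⟨n, hn⟩ := exists_nat_one_div_lt hε
    have := hsub y n (hxy ▸ hxb x n)
    rw [zero_add]
    exact (Metric.mem_ball.1 this).trans hn
  refine (mk_le_of_injective hinj).trans ?_
  simpa using (power_le_power_right (hBX.trans_le hX)).trans hm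

/-! ### Spaces realizing all small Katětov functions -/

/-- `f` is a Katětov function on `A`: the values `f a`, `a ∈ A`, are admissible as the distances
from the points of `A` to one further point. Values of `f` off `A` are irrelevant. -/
def IsKatetovOn {X : Type*} [PseudoMetricSpace X] (f : X → ℝ) (A : Set X) : Prop :=
  ∀ a ∈ A, ∀ b ∈ A, f a ≤ f b + dist a b ∧ dist a b ≤ f a + f b

/-- `X` realizes Katětov functions on sets of cardinality `< m`: each of them is the distance to
some point of `X`. -/
def RealizesKatetov (m : Cardinal.{u}) (X : Type u) [PseudoMetricSpace X] : Prop :=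
  ∀ (A : Set X) (f : X → ℝ), #A < m → IsKatetovOn f A → ∃ x, ∀ a ∈ A, dist x a = f a

theorem IsKatetovOn.of_isometry_on {X Y : Type*} [PseudoMetricSpace X] [PseudoMetricSpace Y]
    {A : Set X} {i : A → Y} (hi : Isometry i) (y : Y) {f : X → ℝ}
    (hf : ∀ a : A, f a = dist y (i a)) : IsKatetovOn f A := by
  intro a ha b hb
  rw [hf ⟨a, ha⟩, hf ⟨b, hb⟩, ← Subtype.dist_eq ⟨a, ha⟩ ⟨b, hb⟩, ← hi.dist_eq]
  exact ⟨(dist_triangle _ _ _).trans_eq (by rw [dist_comm (i ⟨b, hb⟩)]),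
    dist_triangle_left _ _ _⟩

/-- A transfinite construction of length `m`. Tasks `T i` are met one after the other by elements
of `P` compatible (`E`) with all those chosen before; this is possible as fewer than `m` elements
have been chosen at each stage. -/
theorem exists_pairwise_of_step {m : Cardinal.{u}} (hm : ℵ₀ ≤ m) {P : Type u} {E : P → P → Prop}
    (hEself : ∀ p, E p p) (hEsymm : ∀ p q, E p q → E q p) (T : m.ord.ToType → Set P) (R₀ : Set P)
    (hR₀ : #R₀ < m) (hE₀ : ∀ p ∈ R₀, ∀ q ∈ R₀, E p q)
    (step : ∀ R : Set P, #R < m → (∀ p ∈ R, ∀ q ∈ R, E p q) → ∀ i, ∃ p ∈ T i, ∀ q ∈ R, E p q) :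
    ∃ R : Set P, R₀ ⊆ R ∧ (∀ p ∈ R, ∀ q ∈ R, E p q) ∧ ∀ i, ∃ p ∈ R, p ∈ T i := by
  classical
  have : Nonempty m.ord.ToType := nonempty_toType_ord hm
  have : Nonempty P := (step R₀ hR₀ hE₀ (Classical.arbitrary _)).nonempty
  let next : ∀ i : m.ord.ToType, (∀ j, j < i → P) → P := fun i prev =>
    Classical.epsilon fun p => p ∈ T i ∧ ∀ q ∈ R₀ ∪ {q | ∃ j, ∃ h : j < i, prev j h = q}, E p q
  let s : m.ord.ToType → P := IsWellFounded.fix (· < ·) next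
  have hs : ∀ i, s i = Classical.epsilon fun p => p ∈ T i ∧ ∀ q ∈ R₀ ∪ s '' Set.Iio i, E p q := by
    intro i
    rw [show s i = next i fun j _ => s j from IsWellFounded.fix_eq _ _ _]
    simp only [next, exists_prop]
    rfl
  have key : ∀ i, s i ∈ T i ∧ ∀ q ∈ R₀ ∪ s '' Set.Iio i, E (s i) q := by
    intro i
    induction i using WellFoundedLT.induction with
    | ind i ih =>
      rw [hs i]
      refine Classical.epsilon_spec (p := fun p => p ∈ T i ∧ ∀ q ∈ R₀ ∪ s '' Set.Iio i, E p q)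
        (step _ ?_ ?_ i)
      · exact (mk_union_le _ _).trans_lt
          (add_lt_of_lt hm hR₀ (mk_image_le.trans_lt (mk_Iio_toType_lt i)))
      · rintro p (hp | ⟨j, hj, rfl⟩) q (hq | ⟨k, hk, rfl⟩)
        · exact hE₀ p hp q hq
        · exact hEsymm _ _ ((ih k hk).2 p (Or.inl hp))
        · exact (ih j hj).2 q (Or.inl hq)
        · rcases lt_trichotomy j k with h | rfl | h
          · exact hEsymm _ _ ((ih k hk).2 _ (Or.inr ⟨j, h, rfl⟩))
          · exact hEself _
          · exact (ih j hj).2 _ (Or.inr ⟨k, h, rfl⟩)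
  refine ⟨R₀ ∪ Set.range s, Set.subset_union_left, ?_, fun i => ⟨s i, Or.inr ⟨i, rfl⟩, (key i).1⟩⟩
  rintro p (hp | ⟨j, rfl⟩) q (hq | ⟨k, rfl⟩)
  · exact hE₀ p hp q hq
  · exact hEsymm _ _ ((key k).2 p (Or.inl hp))
  · exact (key j).2 q (Or.inl hq)
  · rcases lt_trichotomy j k with h | rfl | h
    · exact hEsymm _ _ ((key k).2 _ (Or.inr ⟨j, h, rfl⟩))
    · exact hEself _
    · exact (key j).2 _ (Or.inr ⟨k, h, rfl⟩)

/-- A relation between metric spaces is isometric if it preserves distances; such a relation is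
the graph of a partial isometry. -/
def IsIsometricRel {X Y : Type*} [MetricSpace X] [MetricSpace Y] (R : Set (X × Y)) : Prop :=
  ∀ p ∈ R, ∀ q ∈ R, dist p.1 q.1 = dist p.2 q.2

section
variable {m : Cardinal.{u}} {X Y : Type u} [MetricSpace X] [MetricSpace Y]

theorem IsIsometricRel.image_swap {R : Set (X × Y)} (hR : IsIsometricRel R) :
    IsIsometricRel (Prod.swap '' R) := by
  rintro _ ⟨p, hp, rfl⟩ _ ⟨q, hq, rfl⟩
  exact (hR p hp q hq).symm

/-- The one-point step of back-and-forth: a small partial isometry into a space realizing Katětov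
functions extends to any further point. -/
theorem RealizesKatetov.exists_extend (hY : RealizesKatetov m Y) {R : Set (X × Y)} (hR : #R < m)
    (hE : IsIsometricRel R) (x : X) : ∃ y, ∀ q ∈ R, dist x q.1 = dist y q.2 := by
  have hex : ∀ b : Prod.snd '' R, ∃ a, (a, (b : Y)) ∈ R := by
    rintro ⟨_, ⟨⟨a, b⟩, hab, rfl⟩⟩
    exact ⟨a, hab⟩
  choose i hi using hex
  have hiso : Isometry i := Isometry.of_dist_eq fun a b => hE _ (hi a) _ (hi b)
  classical
  obtain ⟨y, hy⟩ := hY (Prod.snd '' R)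
    (fun b => if h : b ∈ Prod.snd '' R then dist x (i ⟨b, h⟩) else 0) (mk_image_le.trans_lt hR)
    (IsKatetovOn.of_isometry_on hiso x fun a => dif_pos a.2)
  refine ⟨y, fun q hq => ?_⟩
  have hq' : q.2 ∈ Prod.snd '' R := ⟨q, hq, rfl⟩
  rw [hy _ hq', dif_pos hq']
  have : q.1 = i ⟨q.2, hq'⟩ := by
    have := hE _ hq _ (hi ⟨q.2, hq'⟩)
    rwa [dist_self, dist_eq_zero] at this
  rw [this]

theorem exists_surjective_toType_ord {P : Type u} [Nonempty P] (hP : #P ≤ m) :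
    ∃ e : m.ord.ToType → P, Function.Surjective e := by
  obtain ⟨f⟩ : #P ≤ #m.ord.ToType := hP.trans_eq (mk_ord_toType m).symm
  exact ⟨Function.invFun f, Function.invFun_surjective f.injective⟩

/-- Going forth only: a space realizing Katětov functions contains every metric space with at most
`m` points. -/
theorem RealizesKatetov.exists_isometry (hm : ℵ₀ ≤ m) (hY : RealizesKatetov m Y) (hX : #X ≤ m) :
    ∃ i : X → Y, Isometry i := by
  cases isEmpty_or_nonempty X with
  | inl h => exact ⟨h.elim, fun x => h.elim x⟩
  | inr h =>
    obtain ⟨e, he⟩ := exists_surjective_toType_ord hX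
    obtain ⟨R, -, hR, hT⟩ := exists_pairwise_of_step hm (P := X × Y)
      (E := fun p q => dist p.1 q.1 = dist p.2 q.2) (fun p => by simp)
      (fun p q h => by rw [dist_comm, h, dist_comm]) (fun i => {p | p.1 = e i}) ∅
      (by simpa using aleph0_pos.trans_le hm) (by simp)
      (fun R hR hE i => by
        obtain ⟨y, hy⟩ := hY.exists_extend hR hE (e i)
        exact ⟨(e i, y), rfl, hy⟩)
    have : ∀ x, ∃ y, (x, y) ∈ R := fun x => by
      obtain ⟨i, rfl⟩ := he x
      obtain ⟨⟨_, y⟩, hp, rfl⟩ := hT i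
      exact ⟨y, hp⟩
    choose i hi using this
    exact ⟨i, Isometry.of_dist_eq fun a b => (hR _ (hi a) _ (hi b)).symm⟩

/-- Back-and-forth: a small partial isometry between two spaces with at most `m` points, both
realizing Katětov functions, extends to a global isometry. -/
theorem RealizesKatetov.exists_isometryEquiv (hm : ℵ₀ ≤ m) (hX : RealizesKatetov m X)
    (hY : RealizesKatetov m Y) (hXm : #X ≤ m) (hYm : #Y ≤ m) {R₀ : Set (X × Y)} (hR₀ : #R₀ < m)
    (hE₀ : IsIsometricRel R₀) : ∃ g : X ≃ᵢ Y, ∀ p ∈ R₀, g p.1 = p.2 := by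
  have : Nonempty X := (hX ∅ 0 (by simpa using aleph0_pos.trans_le hm)
    (by intro a ha; simp at ha)).nonempty
  obtain ⟨e, he⟩ := exists_surjective_toType_ord (P := X ⊕ Y)
    (by simpa using add_le_of_le hm hXm hYm)
  obtain ⟨R, h₀, hR, hT⟩ := exists_pairwise_of_step hm (P := X × Y)
    (E := fun p q => dist p.1 q.1 = dist p.2 q.2) (fun p => by simp)
    (fun p q h => by rw [dist_comm, h, dist_comm])
    (fun i => {p | e i = Sum.inl p.1 ∨ e i = Sum.inr p.2}) R₀ hR₀ hE₀
    (fun R hR hE i => by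
      cases hi : e i with
      | inl x =>
        obtain ⟨y, hy⟩ := hY.exists_extend hR hE x
        exact ⟨(x, y), Or.inl rfl, hy⟩
      | inr y =>
        obtain ⟨x, hx⟩ := hX.exists_extend (mk_image_le.trans_lt hR)
          (IsIsometricRel.image_swap hE) y
        exact ⟨(x, y), Or.inr rfl, fun q hq => (hx _ ⟨q, hq, rfl⟩).symm⟩)
  have hl : ∀ x, ∃ y, (x, y) ∈ R := fun x => by
    obtain ⟨i, hi⟩ := he (Sum.inl x)
    obtain ⟨⟨a, b⟩, hp, h⟩ := hT i
    rw [Set.mem_ofPred_eq, hi] at h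
    obtain rfl : x = a := by simpa using h
    exact ⟨b, hp⟩
  have hr : ∀ y, ∃ x, (x, y) ∈ R := fun y => by
    obtain ⟨i, hi⟩ := he (Sum.inr y)
    obtain ⟨⟨a, b⟩, hp, h⟩ := hT i
    rw [Set.mem_ofPred_eq, hi] at h
    obtain rfl : y = b := by simpa using h
    exact ⟨a, hp⟩
  choose f hf using hl
  choose g hg using hr
  have huniq : ∀ {x y}, (x, y) ∈ R → f x = y := fun {x y} hxy => by
    have := hR _ (hf x) _ hxy
    rwa [dist_self, eq_comm, dist_eq_zero] at this
  exact ⟨IsometryEquiv.mk' f g (fun y => huniq (hg y))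
    (Isometry.of_dist_eq fun a b => (hR _ (hf a) _ (hf b)).symm), fun p hp => huniq (h₀ hp)⟩

/-- The limit of a Cauchy sequence in the completion defines a Katětov function on the countable
range of the sequence, and any point realizing it is a limit. -/
theorem RealizesKatetov.completeSpace (hm : ℵ₀ < m) (hX : RealizesKatetov m X) :
    CompleteSpace X := by
  refine Metric.complete_of_cauchySeq_tendsto fun v hv => ?_
  obtain ⟨y, hy⟩ := cauchySeq_tendsto_of_complete
    (hv.map (UniformSpace.Completion.uniformContinuous_coe X) :
      CauchySeq fun n => (v n : UniformSpace.Completion X))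
  obtain ⟨x, hx⟩ := hX (Set.range v) (fun a => dist y (a : UniformSpace.Completion X))
    ((Set.countable_range v).le_aleph0.trans_lt hm)
    (IsKatetovOn.of_isometry_on
      (UniformSpace.Completion.coe_isometry.comp isometry_subtype_coe) y fun _ => rfl)
  refine ⟨x, ?_⟩
  rw [tendsto_iff_dist_tendsto_zero] at hy ⊢
  refine hy.congr fun n => ?_
  rw [dist_comm (v n), hx _ ⟨n, rfl⟩, dist_comm]

/-- Distinct points of a `1`-separated family have distinct basic neighbourhoods of radius `1`. -/
theorem le_topWeight_of_one_le_dist {ι : Type u} (i : ι → X)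
    (hi : Pairwise fun a b => 1 ≤ dist (i a) (i b)) : #ι ≤ topWeight X := by
  obtain ⟨B, hB, hBX⟩ := exists_isTopologicalBasis_mk_eq_topWeight X
  rw [← hBX]
  have h : ∀ a, ∃ b : B, i a ∈ (b : Set X) ∧ (b : Set X) ⊆ Metric.ball (i a) 1 := fun a => by
    obtain ⟨b, hb, hab, hsub⟩ := hB.exists_subset_of_mem_open
      (Metric.mem_ball_self (x := i a) one_pos) Metric.isOpen_ball
    exact ⟨⟨b, hb⟩, hab, hsub⟩
  choose b hb hsub using h
  refine mk_le_of_injective (f := b) fun a c hac => ?_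
  by_contra hne
  exact (hi hne).not_gt (Metric.mem_ball.1 (hsub c (hac ▸ hb a)))

/-- The metric with all nonzero distances equal to `1`. -/
@[reducible] def discreteUnitMetric (D : Type*) [DecidableEq D] : MetricSpace D where
  dist a b := if a = b then 0 else 1
  dist_self := by simp
  dist_comm a b := by simp only [eq_comm]
  dist_triangle a b c := by
    grind
  eq_of_dist_eq_zero {a b} h := by
    by_contra hne
    simp [hne] at h

theorem RealizesKatetov.isUrysohnKatetov (hm : ℵ₀ < m) (hpow : ∀ n < m, m ^ n ≤ m)
    (hX : RealizesKatetov m X) (hXm : #X ≤ m) : IsUrysohnKatetov m X where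
  complete := hX.completeSpace hm
  weight_eq := by
    refine (topWeight_le_of_mk_le hm.le hXm).antisymm ?_
    classical
    let := discreteUnitMetric m.ord.ToType
    obtain ⟨i, hi⟩ := hX.exists_isometry hm.le (mk_ord_toType m).le
    rw [← mk_ord_toType m]
    refine le_topWeight_of_one_le_dist i fun a b hab => ?_
    exact (if_neg hab : dist a b = 1).ge.trans_eq (hi.dist_eq a b).symm
  homogeneous A B hA hB f := by
    obtain ⟨g, hg⟩ := hX.exists_isometryEquiv hm.le hX hXm hXm
      (R₀ := Set.range fun a : A => ((a : X), (f a : X))) (mk_range_le.trans_lt hA) (by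
        rintro _ ⟨a, rfl⟩ _ ⟨b, rfl⟩
        exact (f.isometry.dist_eq a b).symm)
    exact ⟨g, fun a => hg _ ⟨a, rfl⟩⟩
  universal Y _ hY := hX.exists_isometry hm.le (mk_le_of_topWeight_le (hpow _ hm) hY)

/-- The one-point extension `A ∪ {none}` in which the new point has distance `f a` to `a ∈ A`. -/
@[reducible] def IsKatetovOn.optionPseudoMetric {f : X → ℝ} {A : Set X} (hf : IsKatetovOn f A) :
    PseudoMetricSpace (Option A) where
  dist
    | none, none => 0
    | none, some a => f a
    | some a, none => f a
    | some a, some b => dist a b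
  dist_self x := by
    cases x
    · rfl
    · exact dist_self _
  dist_comm x y := by
    cases x <;> cases y <;> first | rfl | exact dist_comm _ _
  dist_triangle x y z := by
    have hself : ∀ a : A, 0 ≤ f a := fun a => by
      have := (hf a a.2 a a.2).2
      rw [dist_self] at this
      linarith
    rcases x with _ | ⟨a, ha⟩ <;> rcases y with _ | ⟨b, hb⟩ <;> rcases z with _ | ⟨c, hc⟩ <;>
      simp only [Subtype.dist_eq]
    · simp
    · simp
    · linarith [hself ⟨b, hb⟩]
    · linarith [(hf c hc b hb).1, dist_comm c b]
    · simp
    · exact (hf a ha c hc).2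
    · linarith [(hf a ha b hb).1]
    · exact dist_triangle _ _ _

/-- Adjoin a point to `A` at the distances prescribed by a Katětov function, embed the result by
universality, and move the copy of `A` back into place by homogeneity. -/
theorem IsUrysohnKatetov.realizesKatetov (hm : ℵ₀ < m) (hX : IsUrysohnKatetov m X) :
    RealizesKatetov m X := by
  intro A f hA hf
  let := hf.optionPseudoMetric
  have hY : #(SeparationQuotient (Option A)) ≤ m := mk_quotient_le.trans <| by
    rw [mk_option]
    exact (add_lt_of_lt hm.le hA (one_lt_aleph0.trans hm)).le
  obtain ⟨i, hi⟩ := hX.universal _ (topWeight_le_of_mk_le hm.le hY)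
  let j : A → X := fun a => i (SeparationQuotient.mk (some a))
  have hj : Isometry j := Isometry.of_dist_eq fun a b => by
    rw [hi.dist_eq, SeparationQuotient.dist_mk]
    rfl
  obtain ⟨g, hg⟩ := hX.homogeneous A (Set.range j) hA (mk_range_le.trans_lt hA)
    hj.isometryEquivOnRange
  refine ⟨g.symm (i (SeparationQuotient.mk none)), fun a ha => ?_⟩
  rw [← g.dist_eq, g.apply_symm_apply, hg ⟨a, ha⟩]
  change dist _ (i _) = _
  rw [hi.dist_eq, SeparationQuotient.dist_mk]
  rfl
end

/-! ### Extending Katětov functions from arbitrary sets of data -/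

/-- `d` satisfies the axioms of a pseudometric at points of `S`. -/
structure IsPseudoDistOn {Z : Type*} (d : Z → Z → ℝ) (S : Set Z) : Prop where
  self : ∀ x ∈ S, d x x = 0
  symm : ∀ x ∈ S, ∀ y ∈ S, d x y = d y x
  triangle : ∀ x ∈ S, ∀ y ∈ S, ∀ z ∈ S, d x z ≤ d x y + d y z

/-- `s` is the graph of a Katětov function on a nonempty subset of `S`, with respect to `d`. -/
structure IsKatetovData {Z : Type*} (d : Z → Z → ℝ) (S : Set Z) (s : Set (Z × ℝ)) : Prop where
  nonempty : s.Nonempty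
  mem : ∀ p ∈ s, p.1 ∈ S
  le_add : ∀ p ∈ s, ∀ q ∈ s, p.2 ≤ q.2 + d q.1 p.1
  dist_le : ∀ p ∈ s, ∀ q ∈ s, d p.1 q.1 ≤ p.2 + q.2

/-- The largest Katětov function with the prescribed values. -/
noncomputable def katetovExt {Z : Type*} (d : Z → Z → ℝ) (s : Set (Z × ℝ)) (x : Z) : ℝ :=
  ⨅ p : s, ((p : Z × ℝ).2 + d (p : Z × ℝ).1 x)

section KatetovExt
variable {Z : Type*} {d : Z → Z → ℝ} {S : Set Z} {s : Set (Z × ℝ)}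

theorem IsPseudoDistOn.nonneg (hd : IsPseudoDistOn d S) {x y : Z} (hx : x ∈ S) (hy : y ∈ S) :
    0 ≤ d x y := by
  linarith [hd.self x hx, hd.symm x hx y hy, hd.triangle x hx y hy x hx]

theorem IsKatetovData.congr {d' : Z → Z → ℝ} (h : ∀ x ∈ S, ∀ y ∈ S, d x y = d' x y)
    (hs : IsKatetovData d S s) : IsKatetovData d' S s where
  nonempty := hs.nonempty
  mem := hs.mem
  le_add p hp q hq := by
    rw [← h _ (hs.mem q hq) _ (hs.mem p hp)]
    exact hs.le_add p hp q hq
  dist_le p hp q hq := by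
    rw [← h _ (hs.mem p hp) _ (hs.mem q hq)]
    exact hs.dist_le p hp q hq

theorem katetovExt_congr {d' : Z → Z → ℝ} (h : ∀ x ∈ S, ∀ y ∈ S, d x y = d' x y)
    (hs : ∀ p ∈ s, p.1 ∈ S) {x : Z} (hx : x ∈ S) : katetovExt d s x = katetovExt d' s x :=
  iInf_congr fun p => by rw [h _ (hs _ p.2) _ hx]

variable (hd : IsPseudoDistOn d S) (hs : IsKatetovData d S s)
include hd hs

theorem IsKatetovData.katetovExt_le {p : Z × ℝ} (hp : p ∈ s) {x : Z} (hx : x ∈ S) :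
    katetovExt d s x ≤ p.2 + d p.1 x := by
  refine ciInf_le ⟨0, ?_⟩ (⟨p, hp⟩ : s)
  rintro _ ⟨⟨q, hq⟩, rfl⟩
  have h1 := hs.dist_le q hq q hq
  rw [hd.self _ (hs.mem q hq)] at h1
  have h2 := hd.nonneg (hs.mem q hq) hx
  change 0 ≤ q.2 + d q.1 x
  linarith

omit hd in
theorem IsKatetovData.le_katetovExt {x : Z} {c : ℝ} (h : ∀ p ∈ s, c ≤ p.2 + d p.1 x) :
    c ≤ katetovExt d s x :=
  have := hs.nonempty.to_subtype
  le_ciInf fun p => h p p.2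

theorem IsKatetovData.katetovExt_apply {p : Z × ℝ} (hp : p ∈ s) : katetovExt d s p.1 = p.2 := by
  refine le_antisymm ?_ (hs.le_katetovExt fun q hq => hs.le_add p hp q hq)
  simpa [hd.self _ (hs.mem p hp)] using hs.katetovExt_le hd hp (hs.mem p hp)

theorem IsKatetovData.katetovExt_le_add {x y : Z} (hx : x ∈ S) (hy : y ∈ S) :
    katetovExt d s x ≤ katetovExt d s y + d x y := by
  rw [← sub_le_iff_le_add]
  refine hs.le_katetovExt fun p hp => ?_
  linarith [hs.katetovExt_le hd hp hx, hd.triangle _ (hs.mem p hp) y hy x hx, hd.symm x hx y hy]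

theorem IsKatetovData.dist_le_katetovExt_add {x y : Z} (hx : x ∈ S) (hy : y ∈ S) :
    d x y ≤ katetovExt d s x + katetovExt d s y := by
  rw [← sub_le_iff_le_add]
  refine hs.le_katetovExt fun p hp => ?_
  rw [sub_le_comm]
  refine hs.le_katetovExt fun q hq => ?_
  linarith [hs.dist_le p hp q hq, hd.triangle x hx _ (hs.mem p hp) y hy,
    hd.triangle _ (hs.mem p hp) _ (hs.mem q hq) y hy, hd.symm x hx _ (hs.mem p hp)]

end KatetovExt

/-! ### The recursive construction of an equivariant metric -/

section Construction
variable {G : Type u} [Group G] [PseudoMetricSpace G] {I : Type u} [LinearOrder I]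

/-- The properties kept up along the recursion for a function `d` on pairs of points of `G × I`
of levels in `J`: it is a pseudometric, invariant under left translations, and translations
move no point by more than they move the points of `G`. -/
structure IsEquivariantDistOn (d : G × I → G × I → ℝ) (J : Set I) : Prop
    extends IsPseudoDistOn d {x | x.2 ∈ J} where
  inv : ∀ (k : G) (x y : G × I), x.2 ∈ J → y.2 ∈ J → d (k * x.1, x.2) (k * y.1, y.2) = d x y
  le_dist : ∀ (g h : G), ∀ j ∈ J, d (g, j) (h, j) ≤ dist g h

variable [OrderBot I] (e : I → Set ((G × I) × ℝ))

open Classical in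
/-- The prescribed distances to the points of level `i`: those in `e i` if they define a Katětov
function on points of lower levels, and otherwise distance `0` to the base point of level `⊥`.
For `i = ⊥` this fallback value is not used, there being no points of lower level. -/
noncomputable def levelData (d : G × I → G × I → ℝ) (i : I) : Set ((G × I) × ℝ) :=
  if IsKatetovData d {x | x.2 ∈ Set.Iio i} (e i) then e i else {((1, ⊥), 0)}

/-- The distances `d (g, i) y` from points of level `i` to points of level `≤ i`, computed from the
distances of points of lower levels. The distance of two points of level `i ≠ ⊥` is the uniform
distance of the Katětov functions that define them. -/
noncomputable def levelDist (d : G × I → G × I → ℝ) (i : I) (g : G) (y : G × I) : ℝ :=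
  if y.2 < i then katetovExt d (levelData e d i) (g⁻¹ * y.1, y.2)
  else if i = ⊥ then dist g y.1
  else ⨆ z : G × Set.Iio i, |katetovExt d (levelData e d i) (g⁻¹ * z.1, (z.2 : I)) -
    katetovExt d (levelData e d i) (y.1⁻¹ * z.1, (z.2 : I))|

/-- The symmetric function of two points obtained from the distances between points and points of
smaller or equal level. -/
def symmetrizeLevels (F : I → G → G × I → ℝ) (x y : G × I) : ℝ :=
  if y.2 ≤ x.2 then F x.2 x.1 y else F y.2 y.1 x

variable {e}

omit [PseudoMetricSpace G] in
theorem levelData_mem (d : G × I → G × I → ℝ) {i : I} (hi : i ≠ ⊥) :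
    ∀ p ∈ levelData e d i, p.1 ∈ {x : G × I | x.2 ∈ Set.Iio i} := by
  intro p hp
  rw [levelData] at hp
  split_ifs at hp with h
  · exact h.mem p hp
  · rw [Set.mem_singleton_iff] at hp
    subst hp
    exact bot_lt_iff_ne_bot.2 hi

theorem levelDist_congr {d d' : G × I → G × I → ℝ} {i : I}
    (h : ∀ x y : G × I, x.2 < i → y.2 < i → d x y = d' x y) :
    levelDist e d i = levelDist e d' i := by
  have h' : ∀ x ∈ {x : G × I | x.2 ∈ Set.Iio i}, ∀ y ∈ {x : G × I | x.2 ∈ Set.Iio i},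
    d x y = d' x y := fun x hx y hy => h x y hx hy
  have hdata : levelData e d i = levelData e d' i := by
    simp only [levelData]
    congr 1
    exact propext ⟨.congr h', .congr fun x hx y hy => (h' x hx y hy).symm⟩
  have hext : i ≠ ⊥ → ∀ x : G × I, x.2 < i →
      katetovExt d (levelData e d i) x = katetovExt d' (levelData e d' i) x := fun hi x hx => by
    rw [← hdata]
    exact katetovExt_congr h' (levelData_mem d hi) hx
  funext g y
  simp only [levelDist]
  split_ifs with h1 h2
  · exact hext (ne_bot_of_gt h1) _ h1
  · rfl
  · exact iSup_congr fun z => by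
      rw [hext h2 (g⁻¹ * z.1, (z.2 : I)) z.2.2, hext h2 (y.1⁻¹ * z.1, (z.2 : I)) z.2.2]

variable (e) in
/-- The recursion: since `levelDist` at `i` depends only on distances between points of levels below
`i`, there is a function `d` whose values at each level are those computed from itself. -/
theorem exists_eq_symmetrizeLevels_levelDist [WellFoundedLT I] :
    ∃ d : G × I → G × I → ℝ, d = symmetrizeLevels fun i => levelDist e d i := by
  classical
  let F : I → G → G × I → ℝ := IsWellFounded.fix (· < ·) fun i prev =>
    levelDist e (symmetrizeLevels fun j => if h : j < i then prev j h else 0) i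
  refine ⟨symmetrizeLevels F, congrArg _ (funext fun i => ?_)⟩
  rw [show F i = _ from IsWellFounded.fix_eq _ _ _]
  refine levelDist_congr fun x y hx hy => ?_
  simp only [symmetrizeLevels, dif_pos hx, dif_pos hy]
  rfl

section Step
variable {d : G × I → G × I → ℝ} (hd : d = symmetrizeLevels fun i => levelDist e d i)
include hd

theorem dist_left_eq_katetovExt {i : I} (g : G) {x : G × I} (hx : x.2 < i) :
    d (g, i) x = katetovExt d (levelData e d i) (g⁻¹ * x.1, x.2) := by
  conv_lhs => rw [hd]
  simp only [symmetrizeLevels, if_pos hx.le, levelDist, if_pos hx]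

theorem dist_right_eq_katetovExt {i : I} (g : G) {x : G × I} (hx : x.2 < i) :
    d x (g, i) = katetovExt d (levelData e d i) (g⁻¹ * x.1, x.2) := by
  conv_lhs => rw [hd]
  simp only [symmetrizeLevels, if_neg hx.not_ge, levelDist, if_pos hx]

theorem dist_bot_bot (g h : G) : d (g, ⊥) (h, ⊥) = dist g h := by
  rw [hd]
  simp [symmetrizeLevels, levelDist]

theorem dist_same_level {i : I} (hi : i ≠ ⊥) (g h : G) :
    d (g, i) (h, i) =
      ⨆ z : G × Set.Iio i, |d (g, i) (z.1, (z.2 : I)) - d (h, i) (z.1, (z.2 : I))| := by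
  simp only [fun (g : G) (z : G × Set.Iio i) =>
    dist_left_eq_katetovExt hd g (x := (z.1, (z.2 : I))) z.2.2]
  conv_lhs => rw [hd]
  simp [symmetrizeLevels, levelDist, hi]

omit [OrderBot I] hd in
theorem IsEquivariantDistOn.of_forall_Iic {J : Set I}
    (h : ∀ j ∈ J, IsEquivariantDistOn d (Set.Iic j)) : IsEquivariantDistOn d J := by
  have hmax : ∀ {i j}, i ∈ J → j ∈ J → max i j ∈ J := fun hi hj => max_rec' (· ∈ J) hi hj
  refine ⟨⟨fun x hx => (h _ hx).self x le_rfl, fun x hx y hy => ?_, fun x hx y hy z hz => ?_⟩,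
    fun k x y hx hy => ?_, fun g h' j hj => (h j hj).le_dist g h' j le_rfl⟩
  · exact (h _ (hmax hx hy)).symm x (le_max_left _ _) y (le_max_right _ _)
  · exact (h _ (hmax hx (hmax hy hz))).triangle x (le_max_left _ _)
      y ((le_max_left _ _).trans (le_max_right _ _))
      z ((le_max_right y.2 z.2).trans (le_max_right _ _))
  · exact (h _ (hmax hx hy)).inv k x y (le_max_left _ _) (le_max_right _ _)

omit [OrderBot I] hd in
/-- The inductive step of the recursion, at a level whose points are given by Katětov functions. -/
theorem IsEquivariantDistOn.Iic_of_Iio {i : I} (hne : (Set.Iio i).Nonempty)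
    (h : IsEquivariantDistOn d (Set.Iio i))
    (hsymm : ∀ (g : G) (x : G × I), x.2 < i → d x (g, i) = d (g, i) x)
    (hle : ∀ (g : G) (x y : G × I), x.2 < i → y.2 < i → d (g, i) x ≤ d (g, i) y + d x y)
    (hadd : ∀ (g : G) (x y : G × I), x.2 < i → y.2 < i → d x y ≤ d (g, i) x + d (g, i) y)
    (hinv : ∀ (k g : G) (x : G × I), x.2 < i → d (k * g, i) (k * x.1, x.2) = d (g, i) x)
    (hdist : ∀ (g h : G) (x : G × I), x.2 < i → d (g, i) x ≤ d (h, i) x + dist g h)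
    (hsup : ∀ g h, d (g, i) (h, i) =
      ⨆ z : G × Set.Iio i, |d (g, i) (z.1, (z.2 : I)) - d (h, i) (z.1, (z.2 : I))|) :
    IsEquivariantDistOn d (Set.Iic i) := by
  have hne' : Nonempty (G × Set.Iio i) := ⟨(1, ⟨_, hne.some_mem⟩)⟩
  have habs : ∀ (g h : G) (x : G × I), x.2 < i → |d (g, i) x - d (h, i) x| ≤ dist g h :=
    fun g h x hx => abs_sub_le_iff.2 ⟨by linarith [hdist g h x hx],
      by linarith [hdist h g x hx, dist_comm g h]⟩
  have hsup_le : ∀ {g h c}, (∀ x : G × I, x.2 < i → |d (g, i) x - d (h, i) x| ≤ c) →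
      d (g, i) (h, i) ≤ c := fun {g h c} hc => by
    rw [hsup]
    exact ciSup_le fun z => hc (z.1, (z.2 : I)) z.2.2
  have hle_sup : ∀ {g h} {x : G × I}, x.2 < i →
      |d (g, i) x - d (h, i) x| ≤ d (g, i) (h, i) := fun {g h x} hx => by
    rw [hsup g h]
    exact le_ciSup (f := fun z : G × Set.Iio i =>
      |d (g, i) (z.1, (z.2 : I)) - d (h, i) (z.1, (z.2 : I))|)
      ⟨dist g h, by rintro _ ⟨z, rfl⟩; exact habs g h _ z.2.2⟩ (x.1, ⟨x.2, hx⟩)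
  have hsplit : ∀ x : G × I, x.2 ∈ Set.Iic i → x.2 < i ∨ ∃ g, x = (g, i) := fun x hx =>
    (lt_or_eq_of_le hx).imp_right fun h => ⟨x.1, Prod.ext rfl h⟩
  have hsymm' : ∀ g h, d (g, i) (h, i) = d (h, i) (g, i) := fun g h => by
    rw [hsup, hsup]
    simp only [abs_sub_comm]
  refine ⟨⟨fun x hx => ?_, fun x hx y hy => ?_, fun x hx y hy z hz => ?_⟩,
    fun k x y hx hy => ?_, fun g h' j hj => ?_⟩
  · rcases hsplit x hx with hx | ⟨g, rfl⟩
    · exact h.self x hx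
    · simp [hsup]
  · rcases hsplit x hx with hx | ⟨g, rfl⟩ <;> rcases hsplit y hy with hy | ⟨h', rfl⟩
    · exact h.symm x hx y hy
    · exact hsymm h' x hx
    · exact (hsymm g y hy).symm
    · exact hsymm' g h'
  · rcases hsplit x hx with hx | ⟨g, rfl⟩ <;> rcases hsplit y hy with hy | ⟨k, rfl⟩ <;>
      rcases hsplit z hz with hz | ⟨l, rfl⟩
    · exact h.triangle x hx y hy z hz
    · linarith [hsymm l x hx, hsymm l y hy, hle l x y hx hy]
    · linarith [hsymm k x hx, hadd k x z hx hz]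
    · linarith [hsymm l x hx, hsymm k x hx, hsymm' k l,
        (abs_sub_le_iff.1 (hle_sup (g := k) (h := l) hx)).2]
    · linarith [hle g z y hz hy, h.symm z hz y hy]
    · refine hsup_le fun x hx => abs_sub_le_iff.2 ⟨?_, ?_⟩
      · linarith [hsymm l y hy, hle g x y hx hy, hadd l x y hx hy]
      · linarith [hsymm l y hy, hle l x y hx hy, hadd g x y hx hy]
    · linarith [(abs_sub_le_iff.1 (hle_sup (g := g) (h := k) hz)).1]
    · refine hsup_le fun x hx => ?_
      exact (abs_sub_le _ (d (k, i) x) _).trans (add_le_add (hle_sup hx) (hle_sup hx))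
  · rcases hsplit x hx with hx | ⟨g, rfl⟩ <;> rcases hsplit y hy with hy | ⟨h', rfl⟩
    · exact h.inv k x y hx hy
    · rw [hsymm _ _ hx, hsymm (k * h') (k * x.1, x.2) hx, hinv k h' x hx]
    · exact hinv k g y hy
    · rw [hsup, hsup]
      refine ((Equiv.prodCongr (Equiv.mulLeft k) (Equiv.refl _)).iSup_congr fun z => ?_).symm
      have := fun g => hinv k g (z.1, (z.2 : I)) z.2.2
      simp only [Equiv.prodCongr_apply, Prod.map, Equiv.coe_mulLeft, Equiv.refl_apply] at this ⊢
      rw [this, this]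
  · rcases lt_or_eq_of_le hj with hj | rfl
    · exact h.le_dist g h' j hj
    · exact hsup_le fun x hx => habs g h' x hx

omit hd in
theorem IsEquivariantDistOn.isKatetovData_levelData {i : I} (hi : i ≠ ⊥)
    (h : IsEquivariantDistOn d (Set.Iio i)) :
    IsKatetovData d {x | x.2 ∈ Set.Iio i} (levelData e d i) := by
  rw [levelData]
  split_ifs with hs
  · exact hs
  · have hbot : ((1, ⊥) : G × I) ∈ {x : G × I | x.2 ∈ Set.Iio i} := bot_lt_iff_ne_bot.2 hi
    refine ⟨Set.singleton_nonempty _, ?_, ?_, ?_⟩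
    · rintro _ rfl
      exact hbot
    all_goals
      rintro _ rfl _ rfl
      simp [h.self _ hbot]

include hd in
/-- The recursively defined `d` is an invariant pseudometric whose displacements are bounded by
those of `G`. -/
theorem isEquivariantDistOn_Iic [IsIsometricSMul G G] [IsIsometricSMul Gᵐᵒᵖ G] [WellFoundedLT I]
    (i : I) : IsEquivariantDistOn d (Set.Iic i) := by
  induction i using WellFoundedLT.induction with
  | ind i ih =>
    rcases eq_or_ne i ⊥ with rfl | hi
    · have hx : ∀ x : G × I, x.2 ∈ Set.Iic ⊥ → ∃ g, x = (g, ⊥) := fun x hx =>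
        ⟨x.1, Prod.ext rfl (le_bot_iff.1 hx)⟩
      refine ⟨⟨fun x h1 => ?_, fun x h1 y h2 => ?_, fun x h1 y h2 z h3 => ?_⟩,
        fun k x y h1 h2 => ?_, fun g h' j hj => ?_⟩
      · obtain ⟨g, rfl⟩ := hx x h1
        simp [dist_bot_bot hd]
      · obtain ⟨g, rfl⟩ := hx x h1
        obtain ⟨h, rfl⟩ := hx y h2
        simp [dist_bot_bot hd, dist_comm]
      · obtain ⟨g, rfl⟩ := hx x h1
        obtain ⟨h, rfl⟩ := hx y h2
        obtain ⟨k, rfl⟩ := hx z h3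
        simpa [dist_bot_bot hd] using dist_triangle _ _ _
      · obtain ⟨g, rfl⟩ := hx x h1
        obtain ⟨h, rfl⟩ := hx y h2
        simp [dist_bot_bot hd]
      · obtain rfl := le_bot_iff.1 hj
        rw [dist_bot_bot hd]
    · have hlt : IsEquivariantDistOn d (Set.Iio i) := .of_forall_Iic fun j hj => ih j hj
      have hs := hlt.isKatetovData_levelData (e := e) hi
      have hP := hlt.toIsPseudoDistOn
      have hl := fun g (x : G × I) (hx : x.2 < i) => dist_left_eq_katetovExt hd g hx
      have hr := fun g (x : G × I) (hx : x.2 < i) => dist_right_eq_katetovExt hd g hx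
      refine hlt.Iic_of_Iio ⟨⊥, bot_lt_iff_ne_bot.2 hi⟩ (fun g x hx => ?_)
        (fun g x y hx hy => ?_) (fun g x y hx hy => ?_) (fun k g x hx => ?_)
        (fun g h x hx => ?_) (dist_same_level hd hi)
      · rw [hl g x hx, hr g x hx]
      · rw [hl g x hx, hl g y hy, ← hlt.inv g⁻¹ x y hx hy]
        exact hs.katetovExt_le_add hP (x := (g⁻¹ * x.1, x.2)) (y := (g⁻¹ * y.1, y.2)) hx hy
      · rw [hl g x hx, hl g y hy, ← hlt.inv g⁻¹ x y hx hy]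
        exact hs.dist_le_katetovExt_add hP (x := (g⁻¹ * x.1, x.2)) (y := (g⁻¹ * y.1, y.2)) hx hy
      · rw [hl (k * g) (k * x.1, x.2) hx, hl g x hx]
        simp [mul_assoc]
      · rw [hl g x hx, hl h x hx]
        -- the displacement bound at lower levels, and bi-invariance of the metric of `G`
        have h1 := hlt.le_dist (g⁻¹ * x.1) (h⁻¹ * x.1) x.2 hx
        rw [dist_mul_right, dist_inv_inv] at h1
        have h2 := hs.katetovExt_le_add hP (x := (g⁻¹ * x.1, x.2)) (y := (h⁻¹ * x.1, x.2)) hx hx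
        linarith

end Step
end Construction

/-! ### Bi-invariant metrics on SIN groups -/

theorem exists_pseudoMetric_rightUniformSpace (G : Type u) [Group G] [t : TopologicalSpace G]
    [IsTopologicalGroup G] [FirstCountableTopology G] :
    ∃ ρ : PseudoMetricSpace G, ρ.toUniformSpace.toTopologicalSpace = t ∧
      ∀ ε > 0, ∃ V ∈ 𝓝 (1 : G), ∀ x y, y * x⁻¹ ∈ V → ρ.dist x y < ε := by
  let := IsTopologicalGroup.rightUniformSpace G
  have : Filter.IsCountablyGenerated (uniformity G) :=
    inferInstanceAs (Filter.IsCountablyGenerated (Filter.comap _ (𝓝 1)))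
  obtain ⟨ρ, hρ⟩ := UniformSpace.metrizable_uniformity G
  refine ⟨ρ, by rw [hρ]; rfl, fun ε hε => ?_⟩
  have h : {p : G × G | ρ.dist p.1 p.2 < ε} ∈ uniformity G := by
    rw [← hρ]
    exact Metric.dist_mem_uniformity hε
  rw [uniformity_eq_comap_nhds_one'] at h
  obtain ⟨V, hV, hVε⟩ := h
  exact ⟨V, hV, fun x y hxy => @hVε (x, y) hxy⟩

/-- A first countable SIN group carries a bi-invariant pseudometric inducing its topology: take
a pseudometric for the right uniformity, cut it off at `1`, and replace it by the supremum of its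
two-sided translates; the supremum is still continuous since conjugations are equicontinuous
at `1`. -/
theorem IsSINGroup.exists_biinvariant_pseudoMetric {G : Type u} [Group G] [t : TopologicalSpace G]
    [IsTopologicalGroup G] [FirstCountableTopology G] (hG : IsSINGroup G) :
    ∃ ρ : PseudoMetricSpace G, ρ.toUniformSpace.toTopologicalSpace = t ∧
      IsIsometricSMul G G ∧ IsIsometricSMul Gᵐᵒᵖ G := by
  obtain ⟨ρ, hρt, hρ⟩ := exists_pseudoMetric_rightUniformSpace G
  let τ : G × G → G → G → ℝ := fun p x y => min 1 (ρ.dist (p.1 * x * p.2) (p.1 * y * p.2))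
  have hτ0 : ∀ p x y, 0 ≤ τ p x y := fun p x y => le_min zero_le_one dist_nonneg
  have hbdd : ∀ x y, BddAbove (Set.range fun p => τ p x y) := fun x y =>
    ⟨1, by rintro _ ⟨p, rfl⟩; exact min_le_left _ _⟩
  let δ : G → G → ℝ := fun x y => ⨆ p, τ p x y
  have hτδ : ∀ p x y, τ p x y ≤ δ x y := fun p x y => le_ciSup (hbdd x y) p
  have hself : ∀ x, δ x x = 0 := fun x => by simp [δ, τ, dist_self]
  have hcomm : ∀ x y, δ x y = δ y x := fun x y => by
    simp only [δ, τ, ρ.dist_comm]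
  have htri : ∀ x y z, δ x z ≤ δ x y + δ y z := fun x y z => ciSup_le fun p => by
    have h1 := hτδ p x y
    have h2 := hτδ p y z
    have h3 := ρ.dist_triangle (p.1 * x * p.2) (p.1 * y * p.2) (p.1 * z * p.2)
    have h4 := hτ0 p x y
    have h5 := hτ0 p y z
    grind
  have hopen : ∀ s : Set G, IsOpen s ↔ ∀ x ∈ s, ∃ ε > 0, ∀ y, δ x y < ε → y ∈ s := by
    intro s
    constructor
    · intro hs x hx
      subst hρt
      obtain ⟨ε, hε, hεs⟩ := Metric.isOpen_iff.1 hs x hx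
      refine ⟨min 1 ε, lt_min one_pos hε, fun y hy => hεs ?_⟩
      have h := (hτδ (1, 1) x y).trans_lt hy
      simp only [τ, one_mul, mul_one] at h
      rw [Metric.mem_ball, dist_comm]
      grind
    · intro h
      refine isOpen_iff_mem_nhds.2 fun x hx => ?_
      obtain ⟨ε, hε, hs⟩ := h x hx
      obtain ⟨V, hV, hVε⟩ := hρ (ε / 2) (half_pos hε)
      obtain ⟨W, hW, hWV⟩ := hG V hV
      have hWx : {y | y * x⁻¹ ∈ W} ∈ 𝓝 x := by
        refine (continuous_mul_const x⁻¹).continuousAt.preimage_mem_nhds ?_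
        simpa using hW
      refine Filter.mem_of_superset hWx fun y hy => hs y ?_
      refine (ciSup_le fun p => ?_).trans_lt (half_lt_self hε)
      refine (min_le_right _ _).trans (hVε _ _ ?_).le
      -- the second translation cancels, the first one acts by conjugation
      have := hWV p.1⁻¹ _ hy
      convert this using 1
      group
  have hl : ∀ g x y, δ (g * x) (g * y) = δ x y := fun g x y =>
    (Equiv.prodCongr (Equiv.mulRight g) (Equiv.refl G)).iSup_congr fun p => by
      simp [τ, mul_assoc]
  have hr : ∀ g x y, δ (x * g) (y * g) = δ x y := fun g x y =>
    (Equiv.prodCongr (Equiv.refl G) (Equiv.mulLeft g)).iSup_congr fun p => by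
      simp [τ, mul_assoc]
  let _ : PseudoMetricSpace G := PseudoMetricSpace.ofDistTopology δ hself hcomm htri hopen
  exact ⟨_, rfl, ⟨fun g => Isometry.of_dist_eq fun x y => hl g x y⟩,
    ⟨fun g => Isometry.of_dist_eq fun x y => hr g.unop x y⟩⟩

/-! ### Actions on Urysohn–Katětov spaces -/

instance SeparationQuotient.instIsIsometricSMul {G X : Type*} [Monoid G] [PseudoMetricSpace X]
    [MulAction G X] [IsIsometricSMul G X] : IsIsometricSMul G (SeparationQuotient X) where
  isometry_smul g := Isometry.of_dist_eq fun x y => by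
    obtain ⟨x, rfl⟩ := SeparationQuotient.surjective_mk x
    obtain ⟨y, rfl⟩ := SeparationQuotient.surjective_mk y
    simp only [← SeparationQuotient.mk_smul, SeparationQuotient.dist_mk, dist_smul]

/-- An isometric action, as a homomorphism to the isometry group. -/
def constSMulIsometryHom (G X : Type*) [Group G] [MetricSpace X] [MulAction G X]
    [IsIsometricSMul G X] : G →* (X ≃ᵢ X) where
  toFun g := IsometryEquiv.constSMul g
  map_one' := IsometryEquiv.ext fun x => one_smul G x
  map_mul' g h := IsometryEquiv.ext fun x => mul_smul g h x

/-- Every group with a bi-invariant pseudometric, of size at most `m`, acts isometrically on a space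
realizing Katětov functions, so that translations by elements close in the group are uniformly close
and the distances of the group are attained on one orbit. The points of the space are those of
`G × m.ord.ToType` with the metric constructed by recursion from an enumeration of all sets of fewer
than `m` prescribed distances. -/
theorem exists_realizesKatetov_action {m : Cardinal.{u}} (hm : ℵ₀ < m) (hpow : ∀ n < m, m ^ n ≤ m)
    (G : Type u) [Group G] [PseudoMetricSpace G] [IsIsometricSMul G G] [IsIsometricSMul Gᵐᵒᵖ G]
    (hG : #G ≤ m) : ∃ (U : Type u) (_ : MetricSpace U) (φ : G →* (U ≃ᵢ U)) (x₀ : U),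
      RealizesKatetov m U ∧ #U ≤ m ∧ (∀ g h x, dist (φ g x) (φ h x) ≤ dist g h) ∧
        ∀ g h, dist (φ g x₀) (φ h x₀) = dist g h := by
  let I := m.ord.ToType
  have : Nonempty I := nonempty_toType_ord hm.le
  let : OrderBot I := WellFoundedLT.toOrderBot I
  have hGI : #(G × I) ≤ m := by
    rw [mk_prod, lift_id, lift_id, mk_ord_toType]
    exact (mul_le_mul_left hG _).trans (mul_eq_self hm.le).le
  have hGIR : #((G × I) × ℝ) ≤ m := by
    have hc : Cardinal.lift.{u} #ℝ ≤ m := by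
      rw [mk_real, lift_continuum, ← two_power_aleph0]
      exact (power_le_power_right (ofNat_le_aleph0.trans hm.le)).trans (hpow _ hm)
    rw [mk_prod, lift_uzero]
    exact (mul_le_mul' hGI hc).trans (mul_eq_self hm.le).le
  have : Nonempty {s : Set ((G × I) × ℝ) // #s < m} := ⟨∅, by simpa using aleph0_pos.trans hm⟩
  obtain ⟨e, he⟩ := exists_cofinal_enumeration hm.le (mk_setOf_card_lt_le hm.le hpow hGIR)
  obtain ⟨d, hd⟩ := exists_eq_symmetrizeLevels_levelDist (G := G) (I := I) fun i => (e i).1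
  have hE : IsEquivariantDistOn d Set.univ :=
    .of_forall_Iic fun i _ => isEquivariantDistOn_Iic hd i
  let : PseudoMetricSpace (G × I) :=
    { dist := d
      dist_self := fun x => hE.self x trivial
      dist_comm := fun x y => hE.symm x trivial y trivial
      dist_triangle := fun x y z => hE.triangle x trivial y trivial z trivial }
  let : MulAction G (G × I) :=
    { smul := fun k x => (k * x.1, x.2)
      one_smul := fun x => Prod.ext (one_mul x.1) rfl
      mul_smul := fun k l x => Prod.ext (mul_assoc k l x.1) rfl }
  have : IsIsometricSMul G (G × I) := ⟨fun k => Isometry.of_dist_eq fun x y =>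
    hE.inv k x y trivial trivial⟩
  refine ⟨SeparationQuotient (G × I), inferInstance, constSMulIsometryHom _ _,
    SeparationQuotient.mk (1, ⊥), ?_, mk_quotient_le.trans hGI, fun g h x => ?_, fun g h => ?_⟩
  · intro A f hA hf
    rcases A.eq_empty_or_nonempty with rfl | hne
    · exact ⟨SeparationQuotient.mk (1, ⊥), by simp⟩
    choose r hr using SeparationQuotient.surjective_mk (X := G × I)
    let s : Set ((G × I) × ℝ) := (fun a => (r a, f a)) '' A
    have hs : #s < m := mk_image_le.trans_lt hA
    obtain ⟨i, hi⟩ := exists_forall_lt_of_isRegular (isRegular_of_power_le hm.le hpow)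
      ((fun a => (r a).2) '' A) (mk_image_le.trans_lt hA)
    obtain ⟨j, hij, hj⟩ := he ⟨s, hs⟩ i
    have hdist : ∀ a b, d (r a) (r b) = dist a b := fun a b => by
      conv_rhs => rw [← hr a, ← hr b, SeparationQuotient.dist_mk]
      rfl
    have hdata : IsKatetovData d {x : G × I | x.2 ∈ Set.Iio j} s := by
      refine ⟨hne.image _, ?_, ?_, ?_⟩
      · rintro _ ⟨a, ha, rfl⟩
        exact (hi _ ⟨a, ha, rfl⟩).trans hij
      · rintro _ ⟨a, ha, rfl⟩ _ ⟨b, hb, rfl⟩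
        rw [hdist, dist_comm]
        exact (hf a ha b hb).1
      · rintro _ ⟨a, ha, rfl⟩ _ ⟨b, hb, rfl⟩
        rw [hdist]
        exact (hf a ha b hb).2
    refine ⟨SeparationQuotient.mk (1, j), fun a ha => ?_⟩
    have haj : (r a).2 < j := (hi _ ⟨a, ha, rfl⟩).trans hij
    have hpseudo : IsPseudoDistOn d {x : G × I | x.2 ∈ Set.Iio j} :=
      ⟨fun x _ => dist_self x, fun x _ y _ => dist_comm x y,
        fun x _ y _ z _ => dist_triangle x y z⟩
    conv_lhs => rw [← hr a, SeparationQuotient.dist_mk]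
    change d (1, j) (r a) = f a
    rw [dist_left_eq_katetovExt hd 1 haj, levelData, hj, if_pos hdata, inv_one, one_mul]
    exact hdata.katetovExt_apply hpseudo ⟨a, ha, rfl⟩
  · obtain ⟨x, rfl⟩ := SeparationQuotient.surjective_mk x
    change dist (SeparationQuotient.mk (g * x.1, x.2)) (SeparationQuotient.mk (h * x.1, x.2)) ≤ _
    rw [SeparationQuotient.dist_mk, ← dist_mul_right g h x.1]
    exact hE.le_dist _ _ _ trivial
  · change dist (SeparationQuotient.mk (g * 1, (⊥ : I)))
      (SeparationQuotient.mk (h * 1, (⊥ : I))) = _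
    rw [SeparationQuotient.dist_mk, mul_one, mul_one]
    exact dist_bot_bot hd g h

/-- Conjugation by an isometry between two spaces, as a homomorphism of isometry groups. -/
def IsometryEquiv.conjHom {X Y : Type*} [MetricSpace X] [MetricSpace Y] (i : X ≃ᵢ Y) :
    (X ≃ᵢ X) →* (Y ≃ᵢ Y) where
  toFun g := (i.symm.trans g).trans i
  map_one' := IsometryEquiv.ext fun y => i.apply_symm_apply y
  map_mul' g h := IsometryEquiv.ext fun y => by
    change i (g (h (i.symm y))) = i (g (i.symm (i (h (i.symm y)))))
    rw [i.symm_apply_apply]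

/-- The upper bound, uniform in `x`, makes `φ` continuous; evaluation at `x₀` inverts it
continuously on its range. -/
theorem isEmbedding_isoPointwise_of_dist {G U : Type u} [Group G] [PseudoMetricSpace G]
    [T0Space G] [MetricSpace U] (φ : G →* (U ≃ᵢ U)) (x₀ : U)
    (hle : ∀ g h x, dist (φ g x) (φ h x) ≤ dist g h)
    (heq : ∀ g h, dist (φ g x₀) (φ h x₀) = dist g h) :
    @IsEmbedding G (U ≃ᵢ U) _ (isoPointwiseTopology U) φ := by
  let := isoPointwiseTopology U
  have hφ : Continuous φ := continuous_induced_rng.2 <| continuous_pi fun x =>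
    (LipschitzWith.of_dist_le_mul (K := 1) fun g h => by simpa using hle g h x).continuous
  have hev : Continuous fun g : U ≃ᵢ U => g x₀ :=
    (continuous_apply x₀).comp continuous_induced_dom
  have hind : IsInducing ((fun g : U ≃ᵢ U => g x₀) ∘ φ) :=
    (Isometry.of_dist_eq heq).isUniformInducing.isInducing
  exact .of_comp hφ hev hind.isEmbedding

theorem mainTheorem9 (m : Cardinal.{u}) (hm : ℵ₀ < m)
    (hpow : (⨆ n : Set.Iio m, m ^ (n : Cardinal.{u})) = m) :
    (∃ (U : Type u) (_ : MetricSpace U), IsUrysohnKatetov m U) ∧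
    (∀ (U U' : Type u) [MetricSpace U] [MetricSpace U'],
      IsUrysohnKatetov m U → IsUrysohnKatetov m U' → Nonempty (U ≃ᵢ U')) ∧
    (∀ (U : Type u) [MetricSpace U], IsUrysohnKatetov m U →
      ∀ (G : Type u) [Group G] [TopologicalSpace G] [IsTopologicalGroup G]
        [TopologicalSpace.MetrizableSpace G],
        IsSINGroup G → topWeight G ≤ m →
          ∃ φ : G →* (U ≃ᵢ U), @IsEmbedding G (U ≃ᵢ U) _ (isoPointwiseTopology U) φ) := by
  have hpow' : ∀ n < m, m ^ n ≤ m := fun n hn => power_le_of_iSup_power_eq hpow hn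
  have hcard : ∀ {U : Type u} [MetricSpace U], IsUrysohnKatetov m U → #U ≤ m := fun hU =>
    mk_le_of_topWeight_le (hpow' _ hm) hU.weight_eq.le
  have hiso : ∀ {U U' : Type u} [MetricSpace U] [MetricSpace U'], RealizesKatetov m U →
      RealizesKatetov m U' → #U ≤ m → #U' ≤ m → Nonempty (U ≃ᵢ U') := fun hU hU' hUm hUm' => by
    obtain ⟨g, -⟩ := hU.exists_isometryEquiv hm.le hU' hUm hUm' (R₀ := ∅)
      (by simpa using aleph0_pos.trans hm) (by intro p hp; simp at hp)
    exact ⟨g⟩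
  refine ⟨?_, fun U U' _ _ hU hU' => ?_, fun U _ hU G _ tG _ _ hSIN hw => ?_⟩
  · have : IsIsometricSMul PUnit.{u + 1} PUnit.{u + 1} := ⟨fun _ => isometry_subsingleton⟩
    have : IsIsometricSMul PUnit.{u + 1}ᵐᵒᵖ PUnit.{u + 1} := ⟨fun _ => isometry_subsingleton⟩
    obtain ⟨U, hU, -, -, hR, hUm, -⟩ := exists_realizesKatetov_action hm hpow' PUnit
      (by simpa using (one_lt_aleph0.trans hm).le)
    exact ⟨U, hU, hR.isUrysohnKatetov hm hpow' hUm⟩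
  · exact hiso (hU.realizesKatetov hm) (hU'.realizesKatetov hm) (hcard hU) (hcard hU')
  · have hGm : #G ≤ m := by
      let := TopologicalSpace.metrizableSpaceMetric G
      exact mk_le_of_topWeight_le (hpow' _ hm) hw
    have hT0 : T0Space G := inferInstance
    obtain ⟨ρ, rfl, _, _⟩ := hSIN.exists_biinvariant_pseudoMetric
    obtain ⟨V, _, φ, x₀, hR, hVm, hle, heq⟩ := exists_realizesKatetov_action hm hpow' G hGm
    obtain ⟨i⟩ := hiso hR (hU.realizesKatetov hm) hVm (hcard hU)
    refine ⟨i.conjHom.comp φ, isEmbedding_isoPointwise_of_dist _ (i x₀) (fun g h x => ?_)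
      fun g h => ?_⟩
    · change dist (i (φ g (i.symm x))) (i (φ h (i.symm x))) ≤ _
      rw [i.dist_eq]
      exact hle g h _
    · change dist (i (φ g (i.symm (i x₀)))) (i (φ h (i.symm (i x₀)))) = _
      rw [i.dist_eq, i.symm_apply_apply]
      exact heq g h
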